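/- Let $n \ge 2$, let $\mathbb{T}^n = \mathbb{R}^n/\mathbb{Z}^n$ be the flat torus and let $T^1\mathbb{T}^n \cong \mathbb{T}^n \times \mathbb{S}_{n-1}$ be its unit tangent bundle, where $\mathbb{S}_{n-1}$ is the Euclidean unit sphere of $\mathbb{R}^n$. Let $\mathrm{Liouv}$ be the normalized Liouville measure on $T^1\mathbb{T}^n$, that is, the product of the Lebesgue probability measure on $\mathbb{T}^n$ and the uniform probability measure on $\mathbb{S}_{n-1}$, and let $(g_t)_{t\in\mathbb{R}}$ be the unit-speed geodesic flow on $T^1\mathbb{T}^n$. Then $(T^1\mathbb{T}^n, \mathrm{Liouv}, (g_t)_{t \in \mathbb{R}})$ exhibits Keplerian shear: the flow preserves the probability measure $\mathrm{Liouv}$ and, for every $f \in \mathbb{L}^2(T^1\mathbb{T}^n, \mathrm{Liouv})$, $$\lim_{t\to+\infty} f\circ g_t = \mathbb{E}_{\mathrm{Liouv}}(f \mid \mathcal{I})$$ in the weak topology of $\mathbb{L}^2(T^1\mathbb{T}^n, \mathrm{Liouv})$, where $\mathcal{I}$ is the $\sigma$-algebra of measurable sets $A$ such that $g_t^{-1}(A)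 = A$ for all $t \in \mathbb{R}$. -/

import Mathlib

open MeasureTheory Filter Topology

/-! ## Keplerian shear of a probability-preserving flow -/

section KeplerianShear

variable {Ω : Type*} [MeasurableSpace Ω]

/-- `(Ω, μ, (g_t)_{t ∈ ℝ})` is a dynamical system preserving a probability measure: `μ` is a
probability measure, `g` is a jointly measurable action of `(ℝ, +)` on `Ω`, and every `g t`
preserves `μ`. -/
structure IsProbPreservingFlow (μ : Measure Ω) (g : ℝ → Ω → Ω) : Prop where
  isProbabilityMeasure : IsProbabilityMeasure μ
  measurable : Measurable (Function.uncurry g)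
  map_zero : ∀ x, g 0 x = x
  map_add : ∀ s t x, g (s + t) x = g s (g t x)
  measurePreserving : ∀ t, MeasurePreserving (g t) μ μ

/-- The invariant `σ`-algebra of the flow: the measurable sets `A` with `g_t⁻¹ A = A` for all
`t ∈ ℝ`. -/
@[reducible] def flowInvariants (g : ℝ → Ω → Ω) : MeasurableSpace Ω :=
  ⨅ t : ℝ, MeasurableSpace.invariants (g t)

theorem measurableSet_flowInvariants (g : ℝ → Ω → Ω) (A : Set Ω) :
    MeasurableSet[flowInvariants g] A ↔ MeasurableSet A ∧ ∀ t : ℝ, g t ⁻¹' A = A := by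
  refine MeasurableSpace.measurableSet_iInf.trans ?_
  exact ⟨fun h => ⟨(h 0).1, fun t => (h t).2⟩, fun h t => ⟨h.1, h.2 t⟩⟩

/-- Keplerian shear: the flow preserves the probability measure `μ`, and for every
`f ∈ L²(Ω, μ; ℂ)` one has `f ∘ g_t → 𝔼_μ(f | 𝓘)` as `t → +∞`, in the weak topology of
`L²(Ω, μ; ℂ)`, where `𝓘` is the invariant `σ`-algebra. -/
def ExhibitsKeplerianShear (μ : Measure Ω) (g : ℝ → Ω → Ω) : Prop :=
  ∃ hg : IsProbPreservingFlow μ g, ∀ (f : Ω → ℂ) (hf : MemLp f 2 μ),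
    Tendsto
      (fun t : ℝ => toWeakSpace ℂ (Lp ℂ 2 μ)
        ((hf.comp_measurePreserving (hg.measurePreserving t)).toLp (f ∘ g t)))
      atTop
      (𝓝 (toWeakSpace ℂ (Lp ℂ 2 μ)
        ((hf.condExp (m := flowInvariants g) one_le_two).toLp (μ[f | flowInvariants g]))))

end KeplerianShear

/-! ## The unit tangent bundle of the flat torus, its Liouville measure and its geodesic flow -/

/-- The unit sphere `𝕊_{n-1}` of the Euclidean space `ℝⁿ`. -/
abbrev UnitSphere (n : ℕ) : Type := Metric.sphere (0 : EuclideanSpace ℝ (Fin n)) 1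

/-- The unit tangent bundle `T¹𝕋ⁿ` of the flat torus `𝕋ⁿ = ℝⁿ/ℤⁿ`: pairs of a base point in `𝕋ⁿ`
and a unit tangent vector at that point. All tangent spaces are identified with the Euclidean space
`ℝⁿ` through the differential of the covering `ℝⁿ → 𝕋ⁿ`, which is a local isometry. -/
abbrev UnitTangentTorus (n : ℕ) : Type := UnitAddTorus (Fin n) × UnitSphere n

/-- The covering map `ℝⁿ → ℝⁿ/ℤⁿ = 𝕋ⁿ`. -/
def torusProj {n : ℕ} (y : EuclideanSpace ℝ (Fin n)) : UnitAddTorus (Fin n) :=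
  fun i => (y i : UnitAddCircle)

/-- The uniform probability measure on `𝕊_{n-1}`: surface measure divided by its total mass. -/
noncomputable def uniformSphere (n : ℕ) : Measure (UnitSphere n) :=
  ((volume : Measure (EuclideanSpace ℝ (Fin n))).toSphere Set.univ)⁻¹ •
    (volume : Measure (EuclideanSpace ℝ (Fin n))).toSphere

/-- The normalized Liouville measure on `T¹𝕋ⁿ`: the Riemannian volume of `𝕋ⁿ` (of total mass `1`)
on the base, and the uniform probability measure on each unit tangent sphere. -/
noncomputable def liouville (n : ℕ) : Measure (UnitTangentTorus n) :=
  (volume : Measure (UnitAddTorus (Fin n))).prod (uniformSphere n)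

/-- `γ : ℝ → 𝕋ⁿ` with velocity field `u` is a geodesic of the flat torus: `γ` has a `C²` lift
`c : ℝ → ℝⁿ` whose velocity is `u` and which satisfies the geodesic equation of the flat metric,
`c'' = 0` (all Christoffel symbols vanish in the coordinates given by the covering). -/
def IsTorusGeodesic {n : ℕ} (γ : ℝ → UnitAddTorus (Fin n)) (u : ℝ → EuclideanSpace ℝ (Fin n)) :
    Prop :=
  ∃ c : ℝ → EuclideanSpace ℝ (Fin n), ContDiff ℝ 2 c ∧ (∀ t, torusProj (c t) = γ t) ∧
    (∀ t, deriv c t = u t) ∧ ∀ t, deriv (deriv c) t = 0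

/-- `g` is the unit-speed geodesic flow on `T¹𝕋ⁿ`: for each unit tangent vector `p = (x, v)`, the
curve `t ↦ g_t p` starts at `p`, and it consists of the points and the velocities of a geodesic of
the flat torus. -/
def IsGeodesicFlow {n : ℕ} (g : ℝ → UnitTangentTorus n → UnitTangentTorus n) : Prop :=
  ∀ p : UnitTangentTorus n, g 0 p = p ∧
    IsTorusGeodesic (fun t => (g t p).1) (fun t => ((g t p).2 : EuclideanSpace ℝ (Fin n)))

/-- The geodesic flow exists and is given by `g_t (x, v) = (x + t v, v)`. -/
theorem isGeodesicFlow_translation (n : ℕ) :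
    IsGeodesicFlow (n := n)
      (fun t p => (p.1 + torusProj (t • (p.2 : EuclideanSpace ℝ (Fin n))), p.2)) := by
  rintro ⟨x, v⟩
  refine ⟨by ext i <;> simp [torusProj], ?_⟩
  choose y hy using fun i => QuotientAddGroup.mk_surjective (x i)
  have hd : deriv (fun t : ℝ => WithLp.toLp 2 y + t • (v : EuclideanSpace ℝ (Fin n)))
      = fun _ => (v : EuclideanSpace ℝ (Fin n)) := by
    funext t
    simpa using (((hasDerivAt_id t).smul_const (v : EuclideanSpace ℝ (Fin n))).const_add
      (WithLp.toLp 2 y)).deriv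
  refine ⟨fun t => WithLp.toLp 2 y + t • (v : EuclideanSpace ℝ (Fin n)), by fun_prop,
    fun t => ?_, fun t => by rw [hd], fun t => by rw [hd]; simp⟩
  funext i
  simp only [torusProj, PiLp.add_apply, Pi.add_apply, AddCircle.coe_add, ← hy i]

/-! A mode `f(x, v) = e_m(x) φ(v)` evolves by `f ∘ g_t = exp(2πi t⟨m, v⟩) f`. If `m = 0`, it is
invariant and is its own conditional expectation. If `m ≠ 0` and `n ≥ 2`, the law of `⟨m, v⟩` on the
sphere is absolutely continuous, so the Riemann–Lebesgue lemma gives `f ∘ g_t → 0` weakly, which in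
turn forces the conditional expectation to vanish (`condExp_flowInvariants_eq_zero`). Modes span a
dense subspace by Stone–Weierstrass, and weak convergence passes to the closure because the Koopman
operators are isometries (`exhibitsKeplerianShear_of_dense`).

Absolute continuity comes from shear: along almost every line parallel to `ξ`, the cosine of the
angle with `ξ` has positive derivative, so it pulls null sets back to null sets. Fubini then gives
the result on the whole space, and homogeneity carries it to the sphere. -/

/-- A function on `ℝ` with positive derivative pulls null sets back to null sets. -/
theorem volume_preimage_eq_zero_of_deriv_pos {F : ℝ → ℝ} (hF : ∀ s, 0 < deriv F s) {N : Set ℝ}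
    (hN : MeasurableSet N) (hN0 : volume N = 0) : volume (F ⁻¹' N) = 0 := by
  have hd : ∀ s, HasDerivAt F (deriv F s) s := fun s =>
    (differentiableAt_of_deriv_ne_zero (hF s).ne').hasDerivAt
  have hc : Continuous F := continuous_iff_continuousAt.2 fun s => (hd s).continuousAt
  have hS : MeasurableSet (F ⁻¹' N) := hc.measurable hN
  -- The integral of `F'` over `F ⁻¹' N` is the measure of a subset of `N`, hence zero; as `F' > 0`,
  -- the domain is null.
  have h := lintegral_deriv_eq_volume_image_of_monotoneOn hS
    (fun s _ => (hd s).hasDerivWithinAt) ((strictMono_of_deriv_pos hF).monotone.monotoneOn _)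
  rw [measure_mono_null (Set.image_preimage_subset F N) hN0,
    lintegral_eq_zero_iff (measurable_deriv F).ennreal_ofReal, EventuallyEq,
    ae_restrict_iff' hS] at h
  refine measure_mono_null (fun s hs => ?_) (ae_iff.1 h)
  simpa [hF s] using hs

/-! ### Absolute continuity of the linear coordinates on the sphere. -/

section Sphere

variable {E : Type*} [NormedAddCommGroup E] [InnerProductSpace ℝ E]

/-- Off the line `ℝ ξ`, the cosine of the angle with `ξ` strictly increases in the direction `ξ`. -/
theorem deriv_inner_div_norm_pos {ξ y : E} (hy : y ∉ Submodule.span ℝ {ξ}) (hξ : ξ ≠ 0) (s : ℝ) :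
    0 < deriv (fun s : ℝ => inner ℝ ξ (y + s • ξ) / ‖y + s • ξ‖) s := by
  set p := y + s • ξ with hp
  have hps : p ∉ Submodule.span ℝ {ξ} := fun h => hy <| by
    simpa [hp] using Submodule.sub_mem _ h
      (Submodule.smul_mem _ s (Submodule.mem_span_singleton_self ξ))
  have hp0 : p ≠ 0 := fun h => hps (h ▸ Submodule.zero_mem _)
  have hpn : 0 < ‖p‖ := norm_pos_iff.2 hp0
  have h1 : HasDerivAt (fun s : ℝ => y + s • ξ) ξ s := by
    simpa using ((hasDerivAt_id s).smul_const ξ).const_add y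
  have h2 : HasDerivAt (fun s : ℝ => inner ℝ ξ (y + s • ξ)) (inner ℝ ξ ξ) s := by
    simpa using (hasDerivAt_const s ξ).inner ℝ h1
  have h3 : HasDerivAt (fun s : ℝ => ‖y + s • ξ‖) (inner ℝ p ξ / ‖p‖) s := by
    have := h1.norm_sq.sqrt (by positivity)
    simp only [Real.sqrt_sq (norm_nonneg _)] at this
    convert! this using 1
    rw [← hp]; field_simp
  rw [(h2.fun_div h3 hpn.ne').deriv, ← hp, real_inner_self_eq_norm_sq, real_inner_comm ξ p]
  have h4 : |inner ℝ ξ p| < ‖ξ‖ * ‖p‖ := by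
    -- Equality in Cauchy–Schwarz would put `p` on the line `ℝ ξ`.
    refine lt_of_le_of_ne (abs_real_inner_le_norm ξ p) fun h => hps ?_
    have := (norm_inner_eq_norm_iff (𝕜 := ℝ) hξ hp0).1 h
    obtain ⟨r, -, hr⟩ := this
    exact Submodule.mem_span_singleton.2 ⟨r, hr.symm⟩
  have h5 := sq_lt_sq' (abs_lt.1 h4).1 (abs_lt.1 h4).2
  refine div_pos ?_ (by positivity)
  have : ‖ξ‖ ^ 2 * ‖p‖ - inner ℝ ξ p * (inner ℝ ξ p / ‖p‖)
      = (‖ξ‖ ^ 2 * ‖p‖ ^ 2 - inner ℝ ξ p ^ 2) / ‖p‖ := by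
    field_simp
  rw [this]
  exact div_pos (by nlinarith) hpn

variable [FiniteDimensional ℝ E] [MeasurableSpace E] [BorelSpace E]

/-- In dimension at least two, the law of the cosine of the angle with `ξ` is absolutely
continuous. -/
theorem ae_inner_div_norm_notMem (μ : Measure E) [μ.IsAddHaarMeasure]
    (hE : 2 ≤ Module.finrank ℝ E) {ξ : E} (hξ : ξ ≠ 0) {N : Set ℝ}
    (hN : MeasurableSet N) (hN0 : volume N = 0) :
    ∀ᵐ y ∂μ, inner ℝ ξ y / ‖y‖ ∉ N := by
  have hspan : μ (Submodule.span ℝ {ξ} : Submodule ℝ E) = 0 := by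
    refine Measure.addHaar_submodule μ _ fun h => ?_
    have h1 := finrank_span_singleton (K := ℝ) hξ
    rw [h, finrank_top] at h1
    omega
  have hmeas : Measurable fun y : E => inner ℝ ξ y / ‖y‖ := by fun_prop
  -- Fubini along lines parallel to `ξ`. Adjoining the null line `ℝ ξ` to the target set disposes of
  -- the one line where the derivative bound fails.
  have key : ∀ᵐ y ∂μ, y ∈ (Submodule.span ℝ {ξ} : Set E) ∪ (fun y => inner ℝ ξ y / ‖y‖) ⁻¹' Nᶜ := by
    refine ae_mem_of_ae_add_linearMap_mem (LinearMap.toSpanSingleton ℝ E ξ) volume μ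
      ((Submodule.closed_of_finiteDimensional _).measurableSet.union (hmeas hN.compl)) fun y => ?_
    by_cases hy : y ∈ Submodule.span ℝ {ξ}
    · refine .of_forall fun s => Or.inl ?_
      exact Submodule.add_mem _ hy (Submodule.smul_mem _ s (Submodule.mem_span_singleton_self ξ))
    · have := measure_eq_zero_iff_ae_notMem.1 <|
        volume_preimage_eq_zero_of_deriv_pos (deriv_inner_div_norm_pos hy hξ) hN hN0
      filter_upwards [this] with s hs
      exact Or.inr hs
  filter_upwards [key, measure_eq_zero_iff_ae_notMem.1 hspan] with y h1 h2
  exact h1.resolve_left h2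

/-- `toSphere` measures a set through the cone over it, and `⟨ξ, y⟩ / ‖y‖` is constant on rays, so
the cone over a bad set is bad in `E`. -/
theorem toSphere_map_inner_absolutelyContinuous (μ : Measure E) [μ.IsAddHaarMeasure]
    (hE : 2 ≤ Module.finrank ℝ E) {ξ : E} (hξ : ξ ≠ 0) :
    (μ.toSphere.map fun v : Metric.sphere (0 : E) 1 => inner ℝ ξ (v : E)) ≪ volume := by
  refine Measure.AbsolutelyContinuous.mk fun N hN hN0 => ?_
  have hm : Measurable fun v : Metric.sphere (0 : E) 1 => inner ℝ ξ (v : E) := by fun_prop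
  rw [Measure.map_apply hm hN, Measure.toSphere_apply' _ (hm hN)]
  refine mul_eq_zero_of_right _ (measure_mono_null ?_
    (ae_iff.1 (ae_inner_div_norm_notMem μ hE hξ hN hN0)))
  rintro _ ⟨r, hr, _, ⟨v, hv, rfl⟩, rfl⟩
  have hv1 : ‖(v : E)‖ = 1 := by simp
  have hr0 : 0 < r := hr.1
  have hrv : inner ℝ ξ (r • (v : E)) / ‖r • (v : E)‖ = inner ℝ ξ (v : E) := by
    rw [inner_smul_right, norm_smul, hv1, Real.norm_of_nonneg hr0.le]; field_simp
  change ¬ inner ℝ ξ (r • (v : E)) / ‖r • (v : E)‖ ∉ N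
  rw [hrv, not_not]
  exact hv

end Sphere

/-! ### Oscillatory integrals. -/

/-- Riemann–Lebesgue lemma along a function with absolutely continuous law. -/
theorem tendsto_integral_fourierChar_mul_of_map_absolutelyContinuous {Ω : Type*}
    [MeasurableSpace Ω] {μ : Measure Ω} [IsFiniteMeasure μ] {F : Ω → ℝ} (hF : Measurable F)
    (hμ : μ.map F ≪ volume) {k : Ω → ℂ} (hk : Integrable k μ) :
    Tendsto (fun t : ℝ => ∫ x, (Real.fourierChar (t * F x) : ℂ) * k x ∂μ) atTop (𝓝 0) := by
  have hb : ∀ (t : ℝ) {k : Ω → ℂ}, Integrable k μ →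
      Integrable (fun x => (Real.fourierChar (t * F x) : ℂ) * k x) μ := fun t k hk => by
    refine hk.bdd_mul (c := 1) ?_ (.of_forall fun x => (Circle.norm_coe _).le)
    exact (Continuous.measurable (by fun_prop : Continuous fun s : ℝ =>
      (Real.fourierChar (t * s) : ℂ)) |>.comp hF).aestronglyMeasurable
  refine Integrable.induction (P := fun k => Tendsto
    (fun t : ℝ => ∫ x, (Real.fourierChar (t * F x) : ℂ) * k x ∂μ) atTop (𝓝 0)) ?_ ?_ ?_ ?_ hk
  · intro c A hA _
    have hac : (μ.restrict A).map F ≪ volume :=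
      (Measure.AbsolutelyContinuous.map Measure.absolutelyContinuous_restrict hF).trans hμ
    -- For `k = c · 1_A` the integral is the Fourier transform, at `-t`, of `c` times the density of
    -- the law of `F` on `A`.
    have hRL := (Real.tendsto_integral_exp_smul_cocompact
      (fun s => (((μ.restrict A).map F).rnDeriv volume s).toReal • c)).comp
      (tendsto_neg_atTop_atBot.mono_right atBot_le_cocompact)
    refine hRL.congr fun t => ?_
    have h1 : ∀ x, (Real.fourierChar (t * F x) : ℂ) * A.indicator (fun _ => c) x
        = A.indicator (fun x => (Real.fourierChar (t * F x) : ℂ) * c) x := fun x => by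
      by_cases hx : x ∈ A <;> simp [hx]
    simp_rw [h1]
    rw [integral_indicator hA]
    have h2 := integral_map (μ := μ.restrict A) hF.aemeasurable
      (f := fun s : ℝ => (Real.fourierChar (t * s) : ℂ) * c)
      (Continuous.aestronglyMeasurable (by fun_prop))
    rw [← h2, ← integral_rnDeriv_smul hac]
    refine integral_congr_ae (.of_forall fun s => ?_)
    simp only [Circle.smul_def, smul_eq_mul, Complex.real_smul]
    rw [show -(s * -t) = t * s by ring]; ring
  · intro f g _ hf hg h1 h2
    have := h1.add h2
    rw [add_zero] at this
    refine this.congr fun t => ?_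
    rw [← integral_add (hb t hf) (hb t hg)]
    simp [mul_add]
  -- The bound by the `L¹` norm is uniform in `t`, so the property is closed in `L¹`.
  · have hcl : ∀ f : Ω →₁[μ] ℂ, ∀ t : ℝ,
        ‖∫ x, (Real.fourierChar (t * F x) : ℂ) * f x ∂μ‖ ≤ ‖f‖ := fun f t => by
      refine (norm_integral_le_integral_norm _).trans ?_
      rw [L1.norm_eq_integral_norm]
      simp_rw [norm_mul, Circle.norm_coe, one_mul]; rfl
    rw [← isSeqClosed_iff_isClosed]
    intro u f hu huf
    simp only [Set.mem_ofPred_eq] at hu ⊢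
    rw [Metric.tendsto_nhds]
    intro ε hε
    obtain ⟨m, hm⟩ := ((tendsto_iff_norm_sub_tendsto_zero.1 huf).eventually_lt_const
      (half_pos hε)).exists
    filter_upwards [(Metric.tendsto_nhds.1 (hu m)) _ (half_pos hε)] with t ht
    rw [dist_zero_right] at ht ⊢
    have h3 : ∫ x, (Real.fourierChar (t * F x) : ℂ) * f x ∂μ
        = ∫ x, (Real.fourierChar (t * F x) : ℂ) * u m x ∂μ
          - ∫ x, (Real.fourierChar (t * F x) : ℂ) * (u m - f : Ω →₁[μ] ℂ) x ∂μ := by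
      rw [← integral_sub (hb t (L1.integrable_coeFn _)) (hb t (L1.integrable_coeFn _))]
      refine integral_congr_ae ?_
      filter_upwards [Lp.coeFn_sub (u m) f] with x hx
      rw [hx, Pi.sub_apply]; ring
    rw [h3]
    refine (norm_sub_le _ _).trans_lt ?_
    linarith [hcl (u m - f) t]
  · intro f g hfg _ h
    refine h.congr fun t => integral_congr_ae ?_
    filter_upwards [hfg] with x hx
    rw [hx]

/-! ### Weak limits, Koopman operators and conditional expectation. -/

/-- The vectors on which a family of linear isometries converges weakly to a bounded operator. -/
def weakLimitSubmodule {ι E : Type*} [NormedAddCommGroup E] [NormedSpace ℂ E]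
    (K : ι → E →ₗᵢ[ℂ] E) (P : E →L[ℂ] E) (l : Filter ι) : Submodule ℂ E where
  carrier := {f | ∀ φ : StrongDual ℂ E, Tendsto (fun t => φ (K t f)) l (𝓝 (φ (P f)))}
  zero_mem' φ := by simpa using tendsto_const_nhds
  add_mem' {f f'} hf hf' φ := by simpa using (hf φ).add (hf' φ)
  smul_mem' c f hf φ := by simpa using (hf φ).const_mul c

theorem isClosed_weakLimitSubmodule {ι E : Type*} [NormedAddCommGroup E] [NormedSpace ℂ E]
    (K : ι → E →ₗᵢ[ℂ] E) (P : E →L[ℂ] E) (l : Filter ι) :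
    IsClosed (weakLimitSubmodule K P l : Set E) := by
  rw [← isSeqClosed_iff_isClosed]
  intro u f hu huf φ
  rw [Metric.tendsto_nhds]
  intro ε hε
  have h1 : Tendsto (fun m => ‖φ‖ * ‖u m - f‖) atTop (𝓝 0) := by
    simpa using (tendsto_iff_norm_sub_tendsto_zero.1 huf).const_mul ‖φ‖
  have h2 : Tendsto (fun m => dist (φ (P (u m))) (φ (P f))) atTop (𝓝 0) :=
    tendsto_iff_dist_tendsto_zero.1 (((φ.comp P).continuous.tendsto f).comp huf)
  obtain ⟨m, hm1, hm2⟩ := ((h1.eventually_lt_const (show 0 < ε / 3 by positivity)).and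
    (h2.eventually_lt_const (show 0 < ε / 3 by positivity))).exists
  filter_upwards [(Metric.tendsto_nhds.1 (hu m φ)) _ (show 0 < ε / 3 by positivity)] with t ht
  have h3 : dist (φ (K t f)) (φ (K t (u m))) ≤ ‖φ‖ * ‖u m - f‖ := by
    rw [dist_eq_norm, ← map_sub, ← map_sub]
    refine (φ.le_opNorm _).trans_eq ?_
    rw [LinearIsometry.norm_map, norm_sub_rev]
  linarith [dist_triangle4 (φ (K t f)) (φ (K t (u m))) (φ (P (u m))) (φ (P f))]

section Koopman

variable {Ω : Type*} [MeasurableSpace Ω] {μ : Measure Ω} {g : ℝ → Ω → Ω}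

theorem flowInvariants_le (g : ℝ → Ω → Ω) : flowInvariants g ≤ ‹MeasurableSpace Ω› :=
  fun A hA => ((measurableSet_flowInvariants g A).1 hA).1

/-- The conditional expectation as a bounded operator of `L²`. -/
noncomputable def condExpLp (μ : Measure Ω) (g : ℝ → Ω → Ω) : Lp ℂ 2 μ →L[ℂ] Lp ℂ 2 μ :=
  (lpMeas ℂ ℂ (flowInvariants g) 2 μ).subtypeL ∘L condExpL2 ℂ ℂ (flowInvariants_le g)

theorem condExpLp_toLp [IsFiniteMeasure μ] {f : Ω → ℂ} (hf : MemLp f 2 μ) :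
    condExpLp μ g (hf.toLp f) =
      (hf.condExp (m := flowInvariants g) one_le_two).toLp (μ[f | flowInvariants g]) := by
  refine Lp.ext ?_
  exact (hf.condExpL2_ae_eq_condExp (𝕜 := ℂ) (flowInvariants_le g)).trans (MemLp.coeFn_toLp _).symm

/-- It is enough to check Keplerian shear on a set of functions whose classes span a dense subspace of `L²`. -/
theorem exhibitsKeplerianShear_of_dense (hg : IsProbPreservingFlow μ g) (S : Set (Ω → ℂ))
    (hS : ∀ f ∈ S, MemLp f 2 μ)
    (hdense : (Submodule.span ℂ {F : Lp ℂ 2 μ | ∃ f ∈ S, F =ᵐ[μ] f}).topologicalClosure = ⊤)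
    (h : ∀ f ∈ S, ∀ k : Ω → ℂ, MemLp k 2 μ → Tendsto (fun t => ∫ x, f (g t x) * k x ∂μ) atTop
      (𝓝 (∫ x, (μ[f | flowInvariants g]) x * k x ∂μ))) :
    ExhibitsKeplerianShear μ g := by
  have := hg.isProbabilityMeasure
  refine ⟨hg, fun f hf => ?_⟩
  let K : ℝ → Lp ℂ 2 μ →ₗᵢ[ℂ] Lp ℂ 2 μ := fun t =>
    Lp.compMeasurePreservingₗᵢ ℂ (g t) (hg.measurePreserving t)
  have htop : weakLimitSubmodule K (condExpLp μ g) atTop = ⊤ := by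
    rw [eq_top_iff, ← hdense]
    refine Submodule.topologicalClosure_minimal _ (Submodule.span_le.2 ?_)
      (isClosed_weakLimitSubmodule _ _ _)
    rintro F ⟨f, hfS, hFf⟩ φ
    have hf := hS f hfS
    obtain rfl : F = hf.toLp f := Lp.ext (hFf.trans hf.coeFn_toLp.symm)
    rw [condExpLp_toLp hf]
    -- Riesz representation; the conjugate of `k` turns the inner product into the bilinear pairing
    -- of `h`.
    obtain ⟨k, rfl⟩ := (InnerProductSpace.toDual ℂ (Lp ℂ 2 μ)).surjective φ
    have hk : MemLp (fun x => starRingEnd ℂ (k x)) 2 μ := (Lp.memLp k).star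
    have := h f hfS _ hk
    simp only [InnerProductSpace.toDual_apply_apply, L2.inner_def, RCLike.inner_apply]
    rw [integral_congr_ae (g := fun x => (μ[f | flowInvariants g]) x * starRingEnd ℂ (k x))]
    · refine this.congr fun t => integral_congr_ae ?_
      filter_upwards [Lp.coeFn_compMeasurePreserving (hf.toLp f) (hg.measurePreserving t),
        (hg.measurePreserving t).quasiMeasurePreserving.ae_eq_comp hf.coeFn_toLp] with x h1 h2
      change _ = Lp.compMeasurePreserving (g t) (hg.measurePreserving t) (hf.toLp f) x * _
      rw [h1, h2, Function.comp_apply]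
    · filter_upwards [(hf.condExp (m := flowInvariants g) one_le_two).coeFn_toLp] with x hx
      rw [hx]
  have hmem : hf.toLp f ∈ weakLimitSubmodule K (condExpLp μ g) atTop := htop ▸ Submodule.mem_top
  refine (WeakBilin.tendsto_iff_forall_eval_tendsto _ fun x y hxy => ?_).2 fun φ => ?_
  · refine (SeparatingDual.eq_iff_forall_dual_eq (R := ℂ) (V := Lp ℂ 2 μ)).2 fun φ => ?_
    exact LinearMap.congr_fun hxy φ
  · rw [← condExpLp_toLp hf]
    exact hmem φ

/-- If `f ∘ g_t` tends weakly to zero, then `f` has zero conditional expectation. -/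
theorem condExp_flowInvariants_eq_zero (hg : IsProbPreservingFlow μ g) {f : Ω → ℂ}
    (hf : MemLp f 2 μ)
    (h : ∀ k : Ω → ℂ, MemLp k 2 μ → Tendsto (fun t => ∫ x, f (g t x) * k x ∂μ) atTop (𝓝 0)) :
    μ[f | flowInvariants g] =ᵐ[μ] 0 := by
  have := hg.isProbabilityMeasure
  refine (ae_eq_condExp_of_forall_setIntegral_eq (flowInvariants_le g) (hf.integrable one_le_two)
    (fun _ _ _ => integrableOn_zero) (fun A hA _ => ?_) aestronglyMeasurable_zero).symm
  obtain ⟨hA, hAg⟩ := (measurableSet_flowInvariants g A).1 hA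
  -- Tested against an invariant set, the correlation does not depend on `t`, so it equals its limit
  -- `0`.
  have h1 := h (A.indicator fun _ => 1) (memLp_indicator_const 2 hA 1 (Or.inr (measure_ne_top _ _)))
  have h2 : ∀ t, ∫ x, f (g t x) * A.indicator (fun _ => (1 : ℂ)) x ∂μ = ∫ x in A, f x ∂μ := by
    intro t
    have h3 : ∀ x, f (g t x) * A.indicator (fun _ => (1 : ℂ)) x = A.indicator f (g t x) := by
      intro x
      have : g t x ∈ A ↔ x ∈ A := by
        conv_rhs => rw [← hAg t]
        rfl
      by_cases hx : x ∈ A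
      · simp [hx, this.2 hx]
      · simp [hx, mt this.1 hx]
    simp_rw [h3]
    rw [← integral_indicator hA]
    have hfm : AEStronglyMeasurable (A.indicator f) μ := hf.1.indicator hA
    rw [← (hg.measurePreserving t).map_eq] at hfm
    conv_rhs => rw [← (hg.measurePreserving t).map_eq]
    rw [integral_map (hg.measurePreserving t).measurable.aemeasurable hfm]
  simp_rw [h2] at h1
  simpa using tendsto_nhds_unique h1 tendsto_const_nhds

end Koopman

/-! ### The geodesic flow and the Fourier modes. -/

section Torus

variable {n : ℕ}

theorem IsGeodesicFlow.eq_translation {g : ℝ → UnitTangentTorus n → UnitTangentTorus n}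
    (hg : IsGeodesicFlow g) :
    g = fun t p => (p.1 + torusProj (t • (p.2 : EuclideanSpace ℝ (Fin n))), p.2) := by
  funext t p
  obtain ⟨h0, c, hc, hcg, hcu, hcc⟩ := hg p
  dsimp only at hcg hcu
  have hd1 : Differentiable ℝ c := hc.differentiable (by norm_num)
  have hd2 : Differentiable ℝ (deriv c) := (hc.deriv' (n := 1)).differentiable (by norm_num)
  have hconst : ∀ t, deriv c t = (p.2 : EuclideanSpace ℝ (Fin n)) := fun t => by
    rw [is_const_of_deriv_eq_zero hd2 hcc t 0, hcu 0, h0]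
  have haff : c t = c 0 + t • (p.2 : EuclideanSpace ℝ (Fin n)) := by
    have hd : Differentiable ℝ fun s : ℝ => c s - s • (p.2 : EuclideanSpace ℝ (Fin n)) := by
      fun_prop
    have := is_const_of_deriv_eq_zero hd (fun s => by
      have h1 := (hd1 s).hasDerivAt.fun_sub
        ((hasDerivAt_id s).smul_const (p.2 : EuclideanSpace ℝ (Fin n)))
      rw [hconst, one_smul, sub_self] at h1
      exact h1.deriv) t 0
    simp only [zero_smul, sub_zero] at this
    rw [← this]; abel
  have hp : torusProj (c 0) = p.1 := by rw [hcg 0, h0]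
  refine Prod.ext ?_ (Subtype.ext ?_) <;> dsimp only
  · rw [← hcg t, haff, ← hp]
    funext i
    simp [torusProj]
  · rw [← hcu t, hconst]

theorem continuous_torusProj : Continuous (torusProj (n := n)) :=
  continuous_pi fun i => (AddCircle.continuous_mk' 1).comp (EuclideanSpace.proj i).continuous

theorem torusProj_add (y z : EuclideanSpace ℝ (Fin n)) :
    torusProj (y + z) = torusProj y + torusProj z := by
  funext i; simp [torusProj]

theorem isProbabilityMeasure_uniformSphere (hn : n ≠ 0) :
    IsProbabilityMeasure (uniformSphere n) := by
  have : Nonempty (Fin n) := ⟨⟨0, Nat.pos_of_ne_zero hn⟩⟩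
  refine ⟨?_⟩
  rw [uniformSphere, Measure.smul_apply, smul_eq_mul]
  exact ENNReal.inv_mul_cancel
    (Measure.measure_univ_ne_zero.2 (Measure.toSphere_ne_zero _)) (measure_ne_top _ _)

theorem isProbabilityMeasure_unitAddTorus {ι : Type*} [Fintype ι] :
    IsProbabilityMeasure (volume : Measure (UnitAddTorus ι)) := by
  have : IsProbabilityMeasure (volume : Measure UnitAddCircle) := ⟨UnitAddCircle.measure_univ⟩
  exact inferInstanceAs (IsProbabilityMeasure (Measure.pi fun _ : ι => volume))

theorem isProbPreservingFlow_translation (hn : n ≠ 0) :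
    IsProbPreservingFlow (liouville n)
      (fun t p => (p.1 + torusProj (t • (p.2 : EuclideanSpace ℝ (Fin n))), p.2)) where
  isProbabilityMeasure := by
    have := isProbabilityMeasure_uniformSphere hn
    have := isProbabilityMeasure_unitAddTorus (ι := Fin n)
    unfold liouville; infer_instance
  measurable := by
    refine Continuous.measurable ?_
    have := continuous_torusProj (n := n)
    simp only [Function.uncurry_def]
    fun_prop
  map_zero p := by
    refine Prod.ext ?_ rfl
    funext i; simp [torusProj]
  map_add s t p := by
    refine Prod.ext ?_ rfl
    simp only [add_smul, torusProj_add]; abel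
  measurePreserving t := by
    have := isProbabilityMeasure_uniformSphere hn
    have := continuous_torusProj (n := n)
    -- For fixed `v` the map is a translation of the torus, which preserves Haar measure. The
    -- factors are swapped so that the direction is the base of the skew product.
    have h : MeasurePreserving
        (fun q : UnitSphere n × UnitAddTorus (Fin n) =>
          (q.1, q.2 + torusProj (t • (q.1 : EuclideanSpace ℝ (Fin n)))))
        ((uniformSphere n).prod volume) ((uniformSphere n).prod volume) := by
      refine (MeasurePreserving.id (uniformSphere n)).skew_product (g := fun (v : UnitSphere n) x =>
        x + torusProj (t • (v : EuclideanSpace ℝ (Fin n))))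
        (Continuous.measurable (by simp only [Function.uncurry_def]; fun_prop))
        (.of_forall fun v => map_add_right_eq_self _ _)
    exact Measure.measurePreserving_swap.comp (h.comp Measure.measurePreserving_swap)

/-- Product of a character of the torus and a continuous function of the direction. -/
noncomputable def torusMode (m : Fin n → ℤ) (φ : C(UnitSphere n, ℂ)) : C(UnitTangentTorus n, ℂ) :=
  ⟨fun p => UnitAddTorus.mFourier m p.1 * φ p.2, by fun_prop⟩

/-- Stone–Weierstrass: modes are stable under products and conjugation, so their span is already a
star subalgebra. -/
theorem span_torusMode_closure_eq_top :
    (Submodule.span ℂ (Set.range fun a : (Fin n → ℤ) × C(UnitSphere n, ℂ) =>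
      torusMode a.1 a.2)).topologicalClosure = ⊤ := by
  classical
  set G : Set C(UnitTangentTorus n, ℂ) := Set.range fun a : (Fin n → ℤ) × C(UnitSphere n, ℂ) =>
    torusMode a.1 a.2
  have hspan : (Algebra.adjoin ℂ G).toSubmodule = Submodule.span ℂ G := by
    apply Algebra.adjoin_eq_span_of_subset
    refine .trans (fun x => Submonoid.closure_induction (fun _ => id) ⟨(0, 1), ?_⟩ ?_)
      Submodule.subset_span
    · ext p
      simp [torusMode, UnitAddTorus.mFourier_zero]
    · rintro _ _ _ _ ⟨⟨m, φ⟩, rfl⟩ ⟨⟨m', φ'⟩, rfl⟩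
      refine ⟨(m + m', φ * φ'), ?_⟩
      ext p
      simp only [torusMode, UnitAddTorus.mFourier_add, ContinuousMap.coe_mk,
        ContinuousMap.mul_apply]
      ring
  let A : StarSubalgebra ℂ C(UnitTangentTorus n, ℂ) :=
    { Algebra.adjoin ℂ G with
      star_mem' := by
        change Algebra.adjoin ℂ G ≤ star (Algebra.adjoin ℂ G)
        refine Algebra.adjoin_le ?_
        rintro _ ⟨⟨m, φ⟩, rfl⟩
        refine Algebra.subset_adjoin ⟨(-m, star φ), ?_⟩
        ext p
        simp [torusMode, UnitAddTorus.mFourier_neg] }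
  have hA : A.SeparatesPoints := by
    rintro ⟨x, v⟩ ⟨y, w⟩ hne
    by_cases hxy : x = y
    · subst hxy
      have hvw : v ≠ w := fun h => hne (h ▸ rfl)
      refine ⟨_, ⟨torusMode 0 ⟨fun u => (dist u w : ℂ), by fun_prop⟩,
        Algebra.subset_adjoin ⟨(_, _), rfl⟩, rfl⟩, ?_⟩
      simpa [torusMode, UnitAddTorus.mFourier_zero] using hvw
    · obtain ⟨i, hi⟩ := Function.ne_iff.1 hxy
      refine ⟨_, ⟨torusMode (Pi.single i 1) 1, Algebra.subset_adjoin ⟨(_, _), rfl⟩, rfl⟩, ?_⟩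
      simp only [torusMode, ContinuousMap.coe_mk, ContinuousMap.one_apply, mul_one,
        UnitAddTorus.mFourier_single, fourier_one, ne_eq]
      exact fun h => hi (AddCircle.injective_toCircle one_ne_zero (Subtype.coe_injective h))
  rw [← hspan]
  exact congr_arg (Subalgebra.toSubmodule <| StarSubalgebra.toSubalgebra ·)
    (ContinuousMap.starSubalgebra_topologicalClosure_eq_top_of_separatesPoints A hA)

theorem mFourier_add_torusProj (m : Fin n → ℤ) (x : UnitAddTorus (Fin n)) (t : ℝ)
    (v : EuclideanSpace ℝ (Fin n)) :
    UnitAddTorus.mFourier m (x + torusProj (t • v)) = UnitAddTorus.mFourier m x *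
      Real.fourierChar (t * inner ℝ (WithLp.toLp 2 fun i => (m i : ℝ)) v) := by
  have h : ∀ i, fourier (m i) ((x + torusProj (t • v)) i) =
      fourier (m i) (x i) * Complex.exp (2 * Real.pi * Complex.I * (m i) * (t * v i)) := fun i => by
    have := fourier_coe_apply (T := 1) (n := m i) (x := t * v i)
    simp only [Complex.ofReal_one, div_one, Complex.ofReal_mul] at this
    rw [← this, fourier_apply, fourier_apply, fourier_apply, Pi.add_apply, smul_add,
      AddCircle.toCircle_add, Circle.coe_mul]
    simp [torusProj]
  simp only [UnitAddTorus.mFourier, ContinuousMap.coe_mk, h, Finset.prod_mul_distrib,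
    ← Complex.exp_sum, Real.fourierChar_apply, PiLp.inner_apply]
  congr 2
  push_cast
  simp only [Finset.mul_sum, Finset.sum_mul]
  refine Finset.sum_congr rfl fun i _ => ?_
  simp
  ring

end Torus

/-! ### Keplerian shear, checked mode by mode. -/

theorem mainTheorem6 (n : ℕ) (hn : 2 ≤ n)
    (g : ℝ → UnitTangentTorus n → UnitTangentTorus n) (hg : IsGeodesicFlow g) :
    ExhibitsKeplerianShear (liouville n) g := by
  have hflow : IsProbPreservingFlow (liouville n) g := by
    rw [hg.eq_translation]
    exact isProbPreservingFlow_translation (by omega)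
  have hprob := hflow.isProbabilityMeasure
  have hσ := isProbabilityMeasure_uniformSphere (n := n) (by omega)
  have hτ := isProbabilityMeasure_unitAddTorus (ι := Fin n)
  have hL2 : ∀ F : C(UnitTangentTorus n, ℂ), MemLp F 2 (liouville n) := fun F =>
    MemLp.of_bound F.continuous.aestronglyMeasurable ‖F‖ (.of_forall F.norm_coe_le_norm)
  refine exhibitsKeplerianShear_of_dense hflow
    (Set.range fun a : (Fin n → ℤ) × C(UnitSphere n, ℂ) => ⇑(torusMode a.1 a.2)) ?_ ?_ ?_
  · rintro _ ⟨a, rfl⟩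
    exact hL2 _
  · rw [eq_top_iff, ← (ContinuousMap.toLp_denseRange (p := 2) ℂ (liouville n) ℂ
      ENNReal.ofNat_ne_top).topologicalClosure_map_submodule span_torusMode_closure_eq_top]
    refine Submodule.topologicalClosure_mono ?_
    rw [Submodule.map_span]
    refine Submodule.span_mono ?_
    rintro _ ⟨_, ⟨a, rfl⟩, rfl⟩
    exact ⟨_, ⟨a, rfl⟩, ContinuousMap.coeFn_toLp _ _⟩
  · rintro _ ⟨⟨m, φ⟩, rfl⟩ k hk
    have hgt : ∀ t p, torusMode m φ (g t p) = Real.fourierChar (t * inner ℝ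
        (WithLp.toLp 2 fun i => (m i : ℝ)) (p.2 : EuclideanSpace ℝ (Fin n))) * torusMode m φ p := by
      intro t p
      rw [hg.eq_translation]
      simp only [torusMode, ContinuousMap.coe_mk, mFourier_add_torusProj]
      ring
    by_cases hm : m = 0
    · subst hm
      have hinv : ∀ t p, torusMode 0 φ (g t p) = torusMode 0 φ p := fun t p => by
        rw [hgt]
        have : (WithLp.toLp 2 fun i => (((0 : Fin n → ℤ) i : ℤ) : ℝ)) =
            (0 : EuclideanSpace ℝ (Fin n)) := by ext i; simp
        rw [this]; simp
      have hmeas : StronglyMeasurable[flowInvariants g] (torusMode 0 φ) := by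
        refine Measurable.stronglyMeasurable fun s hs => ?_
        refine (measurableSet_flowInvariants g _).2 ⟨(torusMode 0 φ).continuous.measurable hs, ?_⟩
        intro t
        ext p
        simp [hinv]
      rw [condExp_of_stronglyMeasurable (flowInvariants_le g) hmeas
        ((hL2 _).integrable one_le_two)]
      simp only [hinv]
      exact tendsto_const_nhds
    · have hξ : (WithLp.toLp 2 fun i => (m i : ℝ) : EuclideanSpace ℝ (Fin n)) ≠ 0 := by
        refine fun h => hm (funext fun i => ?_)
        have := congrArg (fun y : EuclideanSpace ℝ (Fin n) => y i) h
        simpa using this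
      have hac : ((liouville n).map fun p => inner ℝ
          (WithLp.toLp 2 fun i => (m i : ℝ)) (p.2 : EuclideanSpace ℝ (Fin n))) ≪ volume := by
        have h1 := toSphere_map_inner_absolutelyContinuous
          (volume : Measure (EuclideanSpace ℝ (Fin n))) (by simpa using hn) hξ
        have h2 : (liouville n).map Prod.snd = uniformSphere n := by
          rw [liouville]
          exact measurePreserving_snd.map_eq
        have h3 := Measure.map_map (μ := liouville n) (g := fun v : UnitSphere n => inner ℝ
          (WithLp.toLp 2 fun i => (m i : ℝ)) (v : EuclideanSpace ℝ (Fin n)))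
          (by fun_prop) measurable_snd
        rw [h2, uniformSphere, Measure.map_smul] at h3
        refine Measure.AbsolutelyContinuous.trans ?_ h1
        rw [Function.comp_def] at h3
        rw [← h3]
        exact Measure.smul_absolutelyContinuous
      have hzero : ∀ k, MemLp k 2 (liouville n) → Tendsto
          (fun t => ∫ p, torusMode m φ (g t p) * k p ∂(liouville n)) atTop (𝓝 0) := by
        intro k hk
        simp only [hgt, mul_assoc]
        exact tendsto_integral_fourierChar_mul_of_map_absolutelyContinuous (by fun_prop) hac
          ((hL2 _).integrable_mul hk)
      have hcond := condExp_flowInvariants_eq_zero hflow (hL2 (torusMode m φ)) hzero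
      rw [integral_congr_ae (g := fun _ => 0)]
      · simpa using hzero k hk
      · filter_upwards [hcond] with p hp
        rw [hp]; simp
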